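/- Let $\mathcal{H}$ be a finite-dimensional complex Hilbert space and let $\mathcal{B}(\mathcal{H})$ denote the space of linear operators on $\mathcal{H}$. A channel is a completely positive, trace-preserving linear map $T:\mathcal{B}(\mathcal{H})\to\mathcal{B}(\mathcal{H})$, and a state is an operator $\rho\ge 0$ with $\mathrm{tr}(\rho)=1$. Let $\mathcal{C}$ be a closed set of channels (in the finite-dimensional space of linear maps on $\mathcal{B}(\mathcal{H})$), and let $v\in\mathcal{H}$ be a unit vector such that for every $T\in\mathcal{C}$ the state $|v\rangle\langle v|$ is the unique state that is a fixed point of $T$. For a self-adjoint $H\in\mathcal{B}(\mathcal{H})$ and $t\in\mathbb{R}$, let $U_t(X):=e^{-iHt}Xe^{iHt}$, and let $P^\bot:=\mathbb{1}-|v\rangle\langle v|$. Then there exists a constant $C_{\mathcal{C}}<\infty$, depending only on $\mathcal{C}$ and $v$, such that for every self-adjoint $H\in\mathcal{B}(\mathcal{H})$, every $T\in\mathcal{C}$ and every integer $N\ge 1$, $$\mathrm{tr}\Big(P^\bot\,(T\circ U_{1/N})^N(|v\rangle\langle v|)\Big)\le\frac{C_{\mathcal{C}}\,\|H\|^2}{N^2},\qquad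 \mathrm{tr}\Big(P^\bot\sum_{n=0}^{N-1}(U_{1/N}\circ T)^n(|v\rangle\langle v|)\Big)\le\frac{C_{\mathcal{C}}\,\|H\|^2}{N},$$ where $\|H\|$ is the operator norm. -/

import Mathlib

open scoped ComplexOrder CStarAlgebra

noncomputable section

variable {E : Type*} [NormedAddCommGroup E] [InnerProductSpace ℂ E]
  [CompleteSpace E]

/-- The space of linear operators on the Hilbert space `E`. When `E` is finite-dimensional this is
the space of trace-class operators; the operator norm and the trace norm define the same topology
on it. -/
abbrev Op (E : Type*) [NormedAddCommGroup E] [InnerProductSpace ℂ E] : Type _ := E →L[ℂ] E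

/-- Superoperators on `E`: (bounded) linear maps from operators to operators, with their norm
topology. -/
abbrev SuperOp (E : Type*) [NormedAddCommGroup E] [InnerProductSpace ℂ E] : Type _ :=
  Op E →L[ℂ] Op E

/-- The trace of an operator. -/
def opTrace (A : Op E) : ℂ := LinearMap.trace ℂ E (A : E →ₗ[ℂ] E)

/-- A quantum channel: a completely positive and trace-preserving linear map. -/
structure IsChannel (T : SuperOp E) : Prop where
  completelyPositive : ∃ Φ : Op E →CP Op E, ∀ X : Op E, Φ X = T X
  tracePreserving : ∀ X : Op E, opTrace (T X) = opTrace X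

/-- A quantum state: a positive semi-definite operator with trace one. -/
structure IsState (ρ : Op E) : Prop where
  isPositive : ρ.IsPositive
  trace_eq_one : opTrace ρ = 1

/-- The rank-one operator `|v⟩⟨v|`, that is `x ↦ ⟪v, x⟫ v`. -/
def ketbra (v : E) : Op E := InnerProductSpace.rankOne ℂ v v

/-- `P^⊥ = 1 - |v⟩⟨v|`. -/
def perpProj (v : E) : Op E := 1 - ketbra v

/-- The unitary operator `e^{-iHt}`. -/
def evolution (H : Op E) (t : ℝ) : Op E := NormedSpace.exp ((-(Complex.I * (t : ℂ))) • H)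

/-- The superoperator `U_t : X ↦ e^{-iHt} X e^{iHt}`. -/
def unitaryFlow (H : Op E) (t : ℝ) : SuperOp E :=
  ((ContinuousLinearMap.mul ℂ (Op E)) (evolution H t)).comp
    ((ContinuousLinearMap.mul ℂ (Op E)).flip (evolution H (-t)))

end

/-! ### Positive functionals and Cauchy–Schwarz -/

section TraceFunctionals

variable {E : Type*} [NormedAddCommGroup E] [InnerProductSpace ℂ E]

/-! Call `ℓ X = Re tr (P^⊥ X)` the leakage. A positive functional that vanishes on the pure state
`|v⟩⟨v|` cannot see coherences with `v`, by Cauchy–Schwarz, so a bound by `c * tr` improves to a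
bound by `c * ℓ` (`positive_functional_le_leakage`). Hence channels fixing `|v⟩⟨v|` never increase
`ℓ`. Uniqueness of the fixed state makes Cesàro averages converge to it along a subsequence, and
compactness of `𝒞` times the states gives one `k` with `ℓ ∘ T ^ k ≤ ℓ / 2` for all `T ∈ 𝒞`
(`exists_uniform_leakage_contraction`).

The sum `w` of `ℓ ∘ T ^ j` over `j < k` then contracts at every step by `1 - r`, with `r = 1 /
(2k)`. Weighted Cauchy–Schwarz shows that a unitary kick of size `‖H‖ / N` multiplies `w` by at most
`1 + r` and adds `O(‖H‖² / N²)`, with no first-order term. As `(1 - r) * (1 + r) < 1`, the leakage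
stays `O(‖H‖² / N²)` for all times; summing `N` such terms gives the second bound. -/

lemma opTrace_mul_comm (A B : Op E) : opTrace (A * B) = opTrace (B * A) :=
  LinearMap.trace_mul_comm ℂ (A : E →ₗ[ℂ] E) (B : E →ₗ[ℂ] E)

lemma opTrace_add (A B : Op E) : opTrace (A + B) = opTrace A + opTrace B := by
  simp [opTrace]

lemma opTrace_smul (c : ℂ) (A : Op E) : opTrace (c • A) = c * opTrace A := by
  simp [opTrace]

/-- The real-linear functional `X ↦ Re tr (A X)`. -/
noncomputable def reTraceMul (A : Op E) : Op E →ₗ[ℝ] ℝ where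
  toFun X := (opTrace (A * X)).re
  map_add' X Y := by simp [mul_add, opTrace_add]
  map_smul' c X := by
    rw [mul_smul_comm, ← Complex.coe_smul c (A * X), opTrace_smul]
    simp

lemma reTraceMul_apply (A X : Op E) : reTraceMul A X = (opTrace (A * X)).re := rfl

lemma continuous_reTraceMul [FiniteDimensional ℂ E] (A : Op E) : Continuous (reTraceMul A) := by
  have h : Continuous fun X : Op E ↦ opTrace X :=
    LinearMap.continuous_of_finiteDimensional
      ((LinearMap.trace ℂ E) ∘ₗ (ContinuousLinearMap.coeLM ℂ : Op E →ₗ[ℂ] (E →ₗ[ℂ] E)))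
  exact Complex.continuous_re.comp (h.comp (continuous_const.mul continuous_id))

lemma reTraceMul_add_left (A B X : Op E) :
    reTraceMul (A + B) X = reTraceMul A X + reTraceMul B X := by
  simp [reTraceMul_apply, add_mul, opTrace_add]

lemma reTraceMul_smul_left (c : ℝ) (A X : Op E) :
    reTraceMul (c • A) X = c * reTraceMul A X := by
  rw [reTraceMul_apply, smul_mul_assoc, ← mul_smul_comm, ← reTraceMul_apply, map_smul, smul_eq_mul]

lemma opTrace_nonneg [FiniteDimensional ℂ E] {X : Op E} (hX : 0 ≤ X) : 0 ≤ opTrace X :=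
  ((ContinuousLinearMap.nonneg_iff_isPositive X).1 hX).toLinearMap.trace_nonneg

variable [CompleteSpace E]

lemma opTrace_mul_nonneg [FiniteDimensional ℂ E] {A X : Op E} (hA : 0 ≤ A) (hX : 0 ≤ X) :
    0 ≤ opTrace (A * X) := by
  obtain ⟨B, rfl⟩ := CStarAlgebra.nonneg_iff_eq_star_mul_self.1 hA
  rw [mul_assoc, opTrace_mul_comm]
  exact opTrace_nonneg (star_right_conjugate_nonneg hX B)

lemma reTraceMul_nonneg [FiniteDimensional ℂ E] {A X : Op E} (hA : 0 ≤ A) (hX : 0 ≤ X) :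
    0 ≤ reTraceMul A X :=
  (Complex.nonneg_iff.1 (opTrace_mul_nonneg hA hX)).1

lemma reTraceMul_mono_left [FiniteDimensional ℂ E] {A B X : Op E} (hAB : A ≤ B) (hX : 0 ≤ X) :
    reTraceMul A X ≤ reTraceMul B X := by
  have h := reTraceMul_nonneg (sub_nonneg.2 hAB) hX
  have h2 := reTraceMul_add_left (B - A) A X
  rw [sub_add_cancel] at h2
  linarith

lemma reTraceMul_one_conj_le [FiniteDimensional ℂ E] {X : Op E} (hX : 0 ≤ X) (D : Op E) :
    reTraceMul 1 (D * X * star D) ≤ ‖D‖ ^ 2 * reTraceMul 1 X := by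
  have h1 : reTraceMul 1 (D * X * star D) = reTraceMul (star D * D) X := by
    simp only [reTraceMul_apply, one_mul]
    rw [mul_assoc, opTrace_mul_comm (star D * D) X, opTrace_mul_comm D, mul_assoc]
  have h2 : star D * D ≤ (‖D‖ ^ 2) • (1 : Op E) := by
    have := CStarAlgebra.star_mul_le_algebraMap_norm_sq (a := D)
    rwa [Algebra.algebraMap_eq_smul_one] at this
  rw [h1, ← reTraceMul_smul_left]
  exact reTraceMul_mono_left h2 hX

/-- Weighted Cauchy–Schwarz inequality for a positive functional evaluated on a conjugation. -/
lemma positive_functional_conj_add_le (p : Op E →ₗ[ℝ] ℝ) (hp : ∀ X, 0 ≤ X → 0 ≤ p X)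
    {X : Op E} (hX : 0 ≤ X) (a b : Op E) {δ : ℝ} (hδ : 0 < δ) :
    p ((a + b) * X * star (a + b)) ≤
      (1 + δ) * p (a * X * star a) + (1 + δ⁻¹) * p (b * X * star b) := by
  have hc : 0 < √δ := Real.sqrt_pos.2 hδ
  have hcc : √δ * √δ = δ := Real.mul_self_sqrt hδ.le
  -- Positivity of this conjugation bounds the cross terms by the weighted diagonal ones.
  have h := hp _ (star_right_conjugate_nonneg hX (√δ • a - (√δ)⁻¹ • b))
  have e : (√δ • a - (√δ)⁻¹ • b) * X * star (√δ • a - (√δ)⁻¹ • b) =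
      δ • (a * X * star a) + δ⁻¹ • (b * X * star b) - (a * X * star b + b * X * star a) := by
    have hi : (√δ)⁻¹ * (√δ)⁻¹ = δ⁻¹ := by rw [← mul_inv, hcc]
    simp only [star_sub, star_smul, star_trivial, sub_mul, mul_sub, smul_mul_assoc, smul_sub,
      mul_smul_comm, smul_smul, hcc, hi, mul_inv_cancel₀ hc.ne', inv_mul_cancel₀ hc.ne', one_smul]
    abel
  have e2 : (a + b) * X * star (a + b) =
      a * X * star a + b * X * star b + (a * X * star b + b * X * star a) := by
    simp only [star_add, add_mul, mul_add]
    abel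
  rw [e] at h
  rw [e2]
  simp only [map_add, map_sub, map_smul, smul_eq_mul] at h ⊢
  linarith

end TraceFunctionals

/-! ### Leakage out of a vector state -/

section RankOne

variable {E : Type*} [NormedAddCommGroup E] [InnerProductSpace ℂ E]

lemma ketbra_nonneg (v : E) : 0 ≤ ketbra v :=
  (ContinuousLinearMap.nonneg_iff_isPositive _).2 (InnerProductSpace.isPositive_rankOne_self v)

lemma opTrace_ketbra_mul [FiniteDimensional ℂ E] (v : E) (X : Op E) : opTrace (ketbra v * X) = inner ℂ v (X v) := by
  have h : X * ketbra v = InnerProductSpace.rankOne ℂ (X v) v := by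
    ext w
    simp [ketbra]
  rw [opTrace_mul_comm, h]
  exact InnerProductSpace.trace_rankOne _ _

lemma opTrace_ketbra [FiniteDimensional ℂ E] {v : E} (hv : ‖v‖ = 1) : opTrace (ketbra v) = 1 := by
  have := opTrace_ketbra_mul v 1
  simpa [hv] using this

lemma isState_ketbra [FiniteDimensional ℂ E] {v : E} (hv : ‖v‖ = 1) : IsState (ketbra v) :=
  ⟨InnerProductSpace.isPositive_rankOne_self v, opTrace_ketbra hv⟩

variable [CompleteSpace E]

lemma isStarProjection_ketbra {v : E} (hv : ‖v‖ = 1) : IsStarProjection (ketbra v) :=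
  InnerProductSpace.isStarProjection_rankOne_self hv

lemma isStarProjection_perpProj {v : E} (hv : ‖v‖ = 1) : IsStarProjection (perpProj v) :=
  (isStarProjection_ketbra hv).one_sub

lemma leakage_ketbra {v : E} (hv : ‖v‖ = 1) : reTraceMul (perpProj v) (ketbra v) = 0 := by
  have : perpProj v * ketbra v = 0 := by
    rw [perpProj, sub_mul, one_mul, (isStarProjection_ketbra hv).isIdempotentElem.eq, sub_self]
  rw [reTraceMul_apply, this]
  simp [opTrace]

/-- A positive functional that vanishes on `|v⟩⟨v|` and is dominated by the trace is dominated
by the leakage out of `v`. -/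
lemma positive_functional_le_leakage {v : E} (hv : ‖v‖ = 1) (p : Op E →ₗ[ℝ] ℝ)
    (hp : ∀ X, 0 ≤ X → 0 ≤ p X) (hpv : p (ketbra v) = 0) {c : ℝ}
    (hpc : ∀ X, 0 ≤ X → p X ≤ c * reTraceMul 1 X) {X : Op E} (hX : 0 ≤ X) :
    p X ≤ c * reTraceMul (perpProj v) X := by
  have hP := isStarProjection_ketbra hv
  have hQ := isStarProjection_perpProj hv
  have hsum : perpProj v + ketbra v = 1 := sub_add_cancel _ _
  -- With `P = |v⟩⟨v|`, `P X P ≤ ‖X‖ P` and `p P = 0`.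
  have hPX : p (ketbra v * X * star (ketbra v)) ≤ 0 := by
    have h := CStarAlgebra.star_right_conjugate_le_norm_smul (a := ketbra v) (b := X)
      (hX.isSelfAdjoint)
    have h2 := hp _ (sub_nonneg.2 h)
    rw [map_sub, map_smul, hP.isSelfAdjoint.star_eq, hP.isIdempotentElem.eq, hpv] at h2
    rw [hP.isSelfAdjoint.star_eq]
    simpa using h2
  have hQX : p (perpProj v * X * star (perpProj v)) ≤ c * reTraceMul (perpProj v) X := by
    refine (hpc _ (star_right_conjugate_nonneg hX _)).trans_eq ?_
    simp only [reTraceMul_apply, one_mul]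
    rw [opTrace_mul_comm, hQ.isSelfAdjoint.star_eq, ← mul_assoc, hQ.isIdempotentElem.eq]
  have hQ0 := hp _ (star_right_conjugate_nonneg hX (perpProj v))
  -- The diverging weight `1 + δ⁻¹` multiplies only the vanishing block, so `δ → 0` is allowed.
  have hle (δ : ℝ) (hδ : 0 < δ) : p X ≤ (1 + δ) * (c * reTraceMul (perpProj v) X) := by
    have h := positive_functional_conj_add_le p hp hX (perpProj v) (ketbra v) hδ
    rw [hsum, one_mul, star_one, mul_one] at h
    have : (1 + δ⁻¹) * p (ketbra v * X * star (ketbra v)) ≤ 0 :=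
      mul_nonpos_of_nonneg_of_nonpos (by positivity) hPX
    nlinarith
  have hlim : Filter.Tendsto (fun δ : ℝ ↦ (1 + δ) * (c * reTraceMul (perpProj v) X))
      (nhdsWithin 0 (Set.Ioi 0)) (nhds ((1 + 0) * (c * reTraceMul (perpProj v) X))) :=
    ((continuous_const.add continuous_id).mul continuous_const).continuousWithinAt
  rw [add_zero, one_mul] at hlim
  exact ge_of_tendsto hlim (eventually_nhdsWithin_of_forall hle)

variable [FiniteDimensional ℂ E]

lemma leakage_nonneg {v : E} (hv : ‖v‖ = 1) {X : Op E} (hX : 0 ≤ X) :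
    0 ≤ reTraceMul (perpProj v) X :=
  reTraceMul_nonneg (isStarProjection_perpProj hv).nonneg hX

lemma leakage_le_trace {v : E} (hv : ‖v‖ = 1) {X : Op E} (hX : 0 ≤ X) :
    reTraceMul (perpProj v) X ≤ reTraceMul 1 X :=
  reTraceMul_mono_left (isStarProjection_perpProj hv).le_one hX

/-- The norm of a positive operator is at most its trace. -/
lemma norm_le_reTrace {X : Op E} (hX : 0 ≤ X) : ‖X‖ ≤ reTraceMul 1 X := by
  have key (x : E) (hx : ‖x‖ = 1) : (inner ℂ x (X x)).re ≤ reTraceMul 1 X := by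
    have h := reTraceMul_mono_left (isStarProjection_ketbra hx).le_one hX
    rwa [reTraceMul_apply, opTrace_ketbra_mul] at h
  have htr : 0 ≤ reTraceMul 1 X := reTraceMul_nonneg zero_le_one hX
  obtain ⟨B, hB⟩ := CStarAlgebra.nonneg_iff_eq_star_mul_self.1 hX
  have hBn : ‖B‖ ≤ √(reTraceMul 1 X) := by
    refine ContinuousLinearMap.opNorm_le_of_unit_norm (Real.sqrt_nonneg _) fun x hx ↦ ?_
    apply Real.le_sqrt_of_sq_le
    have h := key x hx
    have e : inner ℂ x (X x) = inner ℂ (B x) (B x) := by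
      rw [hB, ContinuousLinearMap.star_eq_adjoint, mul_apply_eq_comp,
        ContinuousLinearMap.adjoint_inner_right]
    rw [e, inner_self_eq_norm_sq_to_K] at h
    norm_cast at h
  calc ‖X‖ = ‖B‖ * ‖B‖ := by rw [hB, CStarRing.norm_star_mul_self]
    _ ≤ √(reTraceMul 1 X) * √(reTraceMul 1 X) := by gcongr
    _ = reTraceMul 1 X := Real.mul_self_sqrt htr

end RankOne

open Filter Topology

/-! ### Compactness of the state space -/

section States

variable {E : Type*} [NormedAddCommGroup E] [InnerProductSpace ℂ E]

lemma IsState.nonneg {ρ : Op E} (h : IsState ρ) : 0 ≤ ρ :=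
  (ContinuousLinearMap.nonneg_iff_isPositive ρ).2 h.isPositive

lemma isState_iff [FiniteDimensional ℂ E] {ρ : Op E} : IsState ρ ↔ 0 ≤ ρ ∧ reTraceMul 1 ρ = 1 := by
  refine ⟨fun h ↦ ⟨h.nonneg, by simp [reTraceMul_apply, h.trace_eq_one]⟩, fun ⟨h0, h1⟩ ↦
    ⟨(ContinuousLinearMap.nonneg_iff_isPositive ρ).1 h0, ?_⟩⟩
  rw [reTraceMul_apply, one_mul] at h1
  exact Complex.ext h1 (Complex.nonneg_iff.1 (opTrace_nonneg h0)).2.symm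

variable [CompleteSpace E] [FiniteDimensional ℂ E]

lemma IsState.norm_le_one {ρ : Op E} (h : IsState ρ) : ‖ρ‖ ≤ 1 :=
  (norm_le_reTrace h.nonneg).trans_eq (isState_iff.1 h).2

lemma isCompact_setOf_isState : IsCompact {ρ : Op E | IsState ρ} := by
  have : ProperSpace (Op E) := FiniteDimensional.proper ℂ _
  refine Metric.isCompact_of_isClosed_isBounded ?_
    (isBounded_iff_forall_norm_le.2 ⟨1, fun ρ hρ ↦ hρ.norm_le_one⟩)
  simp_rw [isState_iff]
  exact CStarAlgebra.isClosed_nonneg.inter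
    (isClosed_eq (continuous_reTraceMul 1) continuous_const)

end States

/-! ### Positive trace-preserving maps and Cesàro averages -/

section PositiveMaps

variable {E : Type*} [NormedAddCommGroup E] [InnerProductSpace ℂ E]

lemma IsChannel.map_nonneg [CompleteSpace E] {T : SuperOp E} (hT : IsChannel T) {X : Op E}
    (hX : 0 ≤ X) : 0 ≤ T X := by
  obtain ⟨Φ, hΦ⟩ := hT.completelyPositive
  rw [← hΦ, ← map_zero Φ]
  exact OrderHomClass.mono Φ hX

/-- A positive trace-preserving superoperator. -/
structure IsPositiveTracePreserving (T : SuperOp E) : Prop where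
  map_nonneg : ∀ X : Op E, 0 ≤ X → 0 ≤ T X
  trace_map : ∀ X : Op E, opTrace (T X) = opTrace X

lemma IsChannel.isPositiveTracePreserving [CompleteSpace E] {T : SuperOp E} (hT : IsChannel T) :
    IsPositiveTracePreserving T :=
  ⟨fun _ ↦ hT.map_nonneg, hT.tracePreserving⟩

namespace IsPositiveTracePreserving

variable {T S : SuperOp E}

lemma comp (hT : IsPositiveTracePreserving T) (hS : IsPositiveTracePreserving S) :
    IsPositiveTracePreserving (T ∘L S) :=
  ⟨fun X hX ↦ hT.map_nonneg _ (hS.map_nonneg X hX),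
    fun X ↦ (hT.trace_map _).trans (hS.trace_map X)⟩

lemma pow (hT : IsPositiveTracePreserving T) (n : ℕ) : IsPositiveTracePreserving (T ^ n) := by
  induction n with
  | zero => exact ⟨fun X hX ↦ hX, fun X ↦ rfl⟩
  | succ n ih => rw [pow_succ]; exact ih.comp hT

lemma reTrace_map (hT : IsPositiveTracePreserving T) (X : Op E) :
    reTraceMul 1 (T X) = reTraceMul 1 X := by
  simp [reTraceMul_apply, hT.trace_map]

variable [FiniteDimensional ℂ E]

lemma isState_map (hT : IsPositiveTracePreserving T) {ρ : Op E} (hρ : IsState ρ) :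
    IsState (T ρ) := by
  rw [isState_iff] at hρ ⊢
  exact ⟨hT.map_nonneg _ hρ.1, (hT.reTrace_map ρ).trans hρ.2⟩

variable [CompleteSpace E]

/-- If every state leaks at most `c` under `T`, then `T` multiplies the leakage out of an
invariant vector state by at most `c`. -/
lemma leakage_map_le_mul {v : E} (hv : ‖v‖ = 1) (hT : IsPositiveTracePreserving T)
    (hTv : T (ketbra v) = ketbra v) {c : ℝ}
    (hc : ∀ X, 0 ≤ X → reTraceMul (perpProj v) (T X) ≤ c * reTraceMul 1 X) {X : Op E}
    (hX : 0 ≤ X) : reTraceMul (perpProj v) (T X) ≤ c * reTraceMul (perpProj v) X := by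
  refine positive_functional_le_leakage hv
    (reTraceMul (perpProj v) ∘ₗ (T : Op E →ₗ[ℂ] Op E).restrictScalars ℝ)
    (fun X hX ↦ leakage_nonneg hv (hT.map_nonneg X hX)) ?_ hc hX
  simp [hTv, leakage_ketbra hv]

/-- The leakage out of an invariant vector state does not increase. -/
lemma leakage_map_le {v : E} (hv : ‖v‖ = 1) (hT : IsPositiveTracePreserving T)
    (hTv : T (ketbra v) = ketbra v) {X : Op E} (hX : 0 ≤ X) :
    reTraceMul (perpProj v) (T X) ≤ reTraceMul (perpProj v) X := by
  have h := hT.leakage_map_le_mul hv hTv (c := 1) (fun X hX ↦ ?_) hX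
  · rwa [one_mul] at h
  · rw [one_mul, ← hT.reTrace_map X]
    exact leakage_le_trace hv (hT.map_nonneg X hX)

lemma antitone_leakage_pow {v : E} (hv : ‖v‖ = 1) (hT : IsPositiveTracePreserving T)
    (hTv : T (ketbra v) = ketbra v) {X : Op E} (hX : 0 ≤ X) :
    Antitone fun n : ℕ ↦ reTraceMul (perpProj v) ((T ^ n) X) := by
  refine antitone_nat_of_succ_le fun n ↦ ?_
  rw [pow_succ']
  exact hT.leakage_map_le hv hTv ((hT.pow n).map_nonneg X hX)

/-- Any state has a subsequence of its Cesàro averages converging to an invariant state. -/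
lemma exists_cesaro_tendsto (hT : IsPositiveTracePreserving T) {ρ : Op E} (hρ : IsState ρ) :
    ∃ σ : Op E, IsState σ ∧ T σ = σ ∧ ∃ φ : ℕ → ℕ, StrictMono φ ∧
      Tendsto (fun n ↦ ((φ n + 1 : ℝ)⁻¹) • ∑ j ∈ Finset.range (φ n + 1), (T ^ j) ρ)
        atTop (𝓝 σ) := by
  set A : ℕ → Op E := fun n ↦ ((n + 1 : ℝ)⁻¹) • ∑ j ∈ Finset.range (n + 1), (T ^ j) ρ with hA
  have hstate (j : ℕ) : IsState ((T ^ j) ρ) := (hT.pow j).isState_map hρ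
  have hAs (n : ℕ) : IsState (A n) := by
    rw [isState_iff]
    refine ⟨smul_nonneg (by positivity) (Finset.sum_nonneg fun j _ ↦ (hstate j).nonneg), ?_⟩
    simp only [hA, map_smul, map_sum, (isState_iff.1 (hstate _)).2, smul_eq_mul]
    simp only [Finset.sum_const, Finset.card_range, nsmul_eq_mul, mul_one]
    push_cast
    exact inv_mul_cancel₀ (by positivity)
  obtain ⟨σ, hσ, φ, hφ, hlim⟩ := isCompact_setOf_isState.tendsto_subseq hAs
  refine ⟨σ, hσ, ?_, φ, hφ, hlim⟩
  -- Telescoping makes the averages asymptotically invariant.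
  have hdiff (n : ℕ) : T (A n) - A n = ((n + 1 : ℝ)⁻¹) • ((T ^ (n + 1)) ρ - ρ) := by
    have e : T (∑ j ∈ Finset.range (n + 1), (T ^ j) ρ) =
        ∑ j ∈ Finset.range (n + 1), (T ^ (j + 1)) ρ := by
      rw [map_sum]
      exact Finset.sum_congr rfl fun j _ ↦ by rw [pow_succ']; rfl
    have e2 := Finset.sum_range_sub (fun j ↦ (T ^ j) ρ) (n + 1)
    simp only [hA]
    rw [ContinuousLinearMap.map_smul_of_tower, e, ← smul_sub, ← Finset.sum_sub_distrib, e2]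
    rfl
  have h0 : Tendsto (fun n ↦ T (A n) - A n) atTop (𝓝 0) := by
    refine squeeze_zero_norm (a := fun n : ℕ ↦ 2 * (1 / ((n : ℝ) + 1))) (fun n ↦ ?_) ?_
    · rw [hdiff, norm_smul, Real.norm_of_nonneg (by positivity), mul_comm, one_div]
      gcongr
      refine (norm_sub_le _ _).trans ?_
      linarith [(hstate (n + 1)).norm_le_one, hρ.norm_le_one]
    · simpa using tendsto_one_div_add_atTop_nhds_zero_nat.const_mul (2 : ℝ)
  have h1 : Tendsto (fun n ↦ T (A (φ n)) - A (φ n)) atTop (𝓝 (T σ - σ)) :=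
    ((T.continuous.tendsto σ).comp hlim).sub hlim
  exact sub_eq_zero.1 (tendsto_nhds_unique h1 (h0.comp hφ.tendsto_atTop))

/-- If a vector state is the only invariant state, then the leakage of any initial state becomes
arbitrarily small. -/
lemma exists_leakage_pow_lt {v : E} (hv : ‖v‖ = 1) (hT : IsPositiveTracePreserving T)
    (hfix : ∀ ρ : Op E, IsState ρ → (T ρ = ρ ↔ ρ = ketbra v)) {ρ : Op E} (hρ : IsState ρ)
    {ε : ℝ} (hε : 0 < ε) : ∃ n : ℕ, reTraceMul (perpProj v) ((T ^ n) ρ) < ε := by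
  obtain ⟨σ, hσ, hTσ, φ, -, hlim⟩ := hT.exists_cesaro_tendsto hρ
  rw [(hfix σ hσ).1 hTσ] at hlim
  have hTv := (hfix _ (isState_ketbra hv)).2 rfl
  have h := ((continuous_reTraceMul (perpProj v)).tendsto _).comp hlim
  rw [leakage_ketbra hv] at h
  obtain ⟨n, hn⟩ := (h.eventually (gt_mem_nhds hε)).exists
  -- The leakage is antitone in time, so its last value is at most its average.
  refine ⟨φ n, lt_of_le_of_lt ?_ hn⟩
  simp only [Function.comp_apply, map_smul, map_sum, smul_eq_mul]
  rw [le_inv_mul_iff₀ (by positivity)]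
  have := Finset.card_nsmul_le_sum (Finset.range (φ n + 1))
    (fun j ↦ reTraceMul (perpProj v) ((T ^ j) ρ)) (reTraceMul (perpProj v) ((T ^ φ n) ρ))
    fun j hj ↦ hT.antitone_leakage_pow hv hTv hρ.nonneg
      (Nat.lt_succ_iff.1 (Finset.mem_range.1 hj))
  simpa using this

end IsPositiveTracePreserving

end PositiveMaps

/-! ### Uniformity over the set of channels -/

section Compactness

variable {E : Type*} [NormedAddCommGroup E] [InnerProductSpace ℂ E] [CompleteSpace E]
  [FiniteDimensional ℂ E]

/-- On `X ≥ 0`, `‖T X‖ ≤ tr (T X) = tr X`. Positive operators span, so the family is pointwise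
bounded, hence norm bounded by Banach–Steinhaus. -/
lemma isCompact_of_isClosed_of_isPositiveTracePreserving {𝒞 : Set (SuperOp E)}
    (hclosed : IsClosed 𝒞) (h𝒞 : ∀ T ∈ 𝒞, IsPositiveTracePreserving T) : IsCompact 𝒞 := by
  have : ProperSpace (SuperOp E) := FiniteDimensional.proper ℂ _
  have : CompleteSpace (Op E) := FiniteDimensional.complete ℂ _
  refine Metric.isCompact_of_isClosed_isBounded hclosed ?_
  have hpt (X : Op E) : ∃ C, ∀ T : 𝒞, ‖(T : SuperOp E) X‖ ≤ C := by
    have hX : X ∈ Submodule.span ℂ {a : Op E | 0 ≤ a} := by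
      rw [CStarAlgebra.span_nonneg]; trivial
    induction hX using Submodule.span_induction with
    | mem X hX =>
      exact ⟨reTraceMul 1 X, fun T ↦ (norm_le_reTrace ((h𝒞 T T.2).map_nonneg X hX)).trans_eq
        ((h𝒞 T T.2).reTrace_map X)⟩
    | zero => exact ⟨0, fun T ↦ by simp⟩
    | add X Y _ _ hX hY =>
      obtain ⟨a, ha⟩ := hX
      obtain ⟨b, hb⟩ := hY
      exact ⟨a + b, fun T ↦ by rw [map_add]; exact norm_add_le_of_le (ha T) (hb T)⟩
    | smul c X _ hX =>
      obtain ⟨a, ha⟩ := hX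
      exact ⟨‖c‖ * a, fun T ↦ by rw [map_smul, norm_smul]; gcongr; exact ha T⟩
  obtain ⟨C, hC⟩ := banach_steinhaus hpt
  exact isBounded_iff_forall_norm_le.2 ⟨C, fun T hT ↦ hC ⟨T, hT⟩⟩

/-- Uniform contraction of the leakage over a closed set of positive trace-preserving maps with a
common unique invariant vector state. -/
lemma exists_uniform_leakage_contraction {𝒞 : Set (SuperOp E)} (hclosed : IsClosed 𝒞)
    (h𝒞 : ∀ T ∈ 𝒞, IsPositiveTracePreserving T) {v : E} (hv : ‖v‖ = 1)
    (hfix : ∀ T ∈ 𝒞, ∀ ρ : Op E, IsState ρ → (T ρ = ρ ↔ ρ = ketbra v)) :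
    ∃ k : ℕ, 1 ≤ k ∧ ∀ T ∈ 𝒞, ∀ X : Op E, 0 ≤ X →
      reTraceMul (perpProj v) ((T ^ k) X) ≤ 1 / 2 * reTraceMul (perpProj v) X := by
  have hTv (T) (hT : T ∈ 𝒞) := (hfix T hT _ (isState_ketbra hv)).2 rfl
  have hcomp := (isCompact_of_isClosed_of_isPositiveTracePreserving hclosed h𝒞).prod
    (isCompact_setOf_isState (E := E))
  obtain ⟨s, hs⟩ := hcomp.elim_finite_subcover
    (fun n : ℕ ↦ {z : SuperOp E × Op E | reTraceMul (perpProj v) ((z.1 ^ n) z.2) < 1 / 2})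
    (fun n ↦ isOpen_lt ((continuous_reTraceMul _).comp
      ((continuous_fst.pow n).clm_apply continuous_snd)) continuous_const)
    (fun z hz ↦ Set.mem_iUnion.2
      ((h𝒞 z.1 hz.1).exists_leakage_pow_lt hv (hfix z.1 hz.1) hz.2 one_half_pos))
  -- Monotonicity lets the largest exponent of the finite subcover serve everywhere; the `+ 1`
  -- ensures `1 ≤ k`.
  refine ⟨s.sup id + 1, by omega, fun T hT X hX ↦ ?_⟩
  have hstate (ρ : Op E) (hρ : IsState ρ) :
      reTraceMul (perpProj v) ((T ^ (s.sup id + 1)) ρ) ≤ 1 / 2 := by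
    obtain ⟨n, hn, h⟩ := Set.mem_iUnion₂.1 (hs (Set.mk_mem_prod hT hρ))
    exact ((h𝒞 T hT).antitone_leakage_pow hv (hTv T hT) hρ.nonneg
      ((Finset.le_sup (f := id) hn).trans (Nat.le_succ _))).trans h.le
  have hTk := (h𝒞 T hT).pow (s.sup id + 1)
  have hTkv : (T ^ (s.sup id + 1)) (ketbra v) = ketbra v := by
    generalize s.sup id + 1 = k
    induction k with
    | zero => rfl
    | succ k ih => rw [pow_succ']; exact (congrArg T ih).trans (hTv T hT)
  refine hTk.leakage_map_le_mul hv hTkv (fun Y hY ↦ ?_) hX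
  have hY0 := reTraceMul_nonneg zero_le_one hY
  rcases hY0.eq_or_lt with h0 | hpos
  · have : Y = 0 := norm_le_zero_iff.1 ((norm_le_reTrace hY).trans_eq h0.symm)
    simp [this]
  · have h := hstate ((reTraceMul 1 Y)⁻¹ • Y) (isState_iff.2
      ⟨smul_nonneg (inv_nonneg.2 hY0) hY, by
        rw [map_smul, smul_eq_mul, inv_mul_cancel₀ hpos.ne']⟩)
    rw [ContinuousLinearMap.map_smul_of_tower, map_smul, smul_eq_mul, inv_mul_le_iff₀ hpos] at h
    linarith

end Compactness

/-! ### Unitary evolution -/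

section Evolution

variable {E : Type*} [NormedAddCommGroup E] [InnerProductSpace ℂ E] [CompleteSpace E]

lemma evolution_neg_mul (H : Op E) (t : ℝ) : evolution H (-t) * evolution H t = 1 := by
  have e : (-(Complex.I * ((-t : ℝ) : ℂ))) • H = -((-(Complex.I * (t : ℂ))) • H) := by
    rw [← neg_smul]; push_cast; congr 1; ring
  have hball (x : Op E) : x ∈ Metric.eball (0 : Op E) (NormedSpace.expSeries ℂ (Op E)).radius := by
    rw [NormedSpace.expSeries_radius_eq_top]; exact edist_lt_top _ _
  rw [evolution, evolution, e, ← NormedSpace.exp_add_of_commute_of_mem_ball (𝕂 := ℂ)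
    (Commute.refl _).neg_left (hball _) (hball _), neg_add_cancel, NormedSpace.exp_zero]

lemma star_evolution {H : Op E} (hH : IsSelfAdjoint H) (t : ℝ) :
    star (evolution H t) = evolution H (-t) := by
  rw [evolution, evolution, NormedSpace.star_exp, star_smul, hH.star_eq]
  simp

lemma norm_evolution_le_one {H : Op E} (hH : IsSelfAdjoint H) (t : ℝ) : ‖evolution H t‖ ≤ 1 := by
  have h : ‖star (evolution H t) * evolution H t‖ ≤ 1 := by
    rw [star_evolution hH, evolution_neg_mul]
    exact ContinuousLinearMap.norm_id_le
  rw [CStarRing.norm_star_mul_self] at h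
  nlinarith [norm_nonneg (evolution H t)]

/-- Mean value inequality along `s ↦ exp (s • A)`, whose derivative is bounded by `‖A‖` because the
exponential is a contraction. -/
lemma norm_evolution_sub_one_le {H : Op E} (hH : IsSelfAdjoint H) (t : ℝ) :
    ‖evolution H t - 1‖ ≤ |t| * ‖H‖ := by
  set A : Op E := (-(Complex.I * (t : ℂ))) • H with hA
  have hnorm : ‖A‖ = |t| * ‖H‖ := by simp [hA, norm_smul]
  have hexp (s : ℝ) : NormedSpace.exp (s • A) = evolution H (s * t) := by
    rw [hA, evolution, ← Complex.coe_smul s, smul_smul]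
    push_cast
    congr 2
    ring
  have h := norm_image_sub_le_of_norm_deriv_le_segment_01' (C := |t| * ‖H‖)
    (f := fun s : ℝ ↦ NormedSpace.exp (s • A))
    (fun s _ ↦ (hasDerivAt_exp_smul_const (𝕂 := ℝ) A s).hasDerivWithinAt) (fun s _ ↦ by
      rw [hexp, ← hnorm]
      calc _ ≤ ‖evolution H (s * t)‖ * ‖A‖ := norm_mul_le _ _
        _ ≤ 1 * ‖A‖ := by gcongr; exact norm_evolution_le_one hH _
        _ = ‖A‖ := one_mul _)
  simpa [hA, evolution] using h

lemma unitaryFlow_apply (H : Op E) (t : ℝ) (X : Op E) :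
    unitaryFlow H t X = evolution H t * X * evolution H (-t) := by
  simp [unitaryFlow, mul_assoc]

lemma unitaryFlow_eq_conj {H : Op E} (hH : IsSelfAdjoint H) (t : ℝ) (X : Op E) :
    unitaryFlow H t X = evolution H t * X * star (evolution H t) := by
  rw [unitaryFlow_apply, star_evolution hH]

lemma isPositiveTracePreserving_unitaryFlow {H : Op E} (hH : IsSelfAdjoint H) (t : ℝ) :
    IsPositiveTracePreserving (unitaryFlow H t) where
  map_nonneg X hX := by
    rw [unitaryFlow_eq_conj hH]
    exact star_right_conjugate_nonneg hX _
  trace_map X := by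
    rw [unitaryFlow_apply, opTrace_mul_comm, ← mul_assoc, evolution_neg_mul, one_mul]

/-- Growth under a unitary flow of a functional dominated by the trace. -/
lemma positive_functional_unitaryFlow_le [FiniteDimensional ℂ E] (w : Op E →ₗ[ℝ] ℝ)
    (hw : ∀ X, 0 ≤ X → 0 ≤ w X) {m : ℝ} (hm : 0 ≤ m)
    (hwm : ∀ X, 0 ≤ X → w X ≤ m * reTraceMul 1 X)
    {H : Op E} (hH : IsSelfAdjoint H) (t : ℝ) {δ : ℝ} (hδ : 0 < δ) {X : Op E} (hX : IsState X) :
    w (unitaryFlow H t X) ≤ (1 + δ) * w X + (1 + δ⁻¹) * (m * (|t| * ‖H‖) ^ 2) := by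
  rw [unitaryFlow_eq_conj hH]
  have h := positive_functional_conj_add_le w hw hX.nonneg 1 (evolution H t - 1) hδ
  rw [add_sub_cancel, one_mul, star_one, mul_one] at h
  refine h.trans ?_
  gcongr
  refine (hwm _ (star_right_conjugate_nonneg hX.nonneg _)).trans ?_
  gcongr
  refine (reTraceMul_one_conj_le hX.nonneg _).trans ?_
  rw [(isState_iff.1 hX).2, mul_one]
  gcongr
  exact norm_evolution_sub_one_le hH t

end Evolution

/-! ### Lyapunov functional and final bounds -/

section Lyapunov

variable {E : Type*} [NormedAddCommGroup E] [InnerProductSpace ℂ E] [CompleteSpace E]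
  [FiniteDimensional ℂ E]

/-- A functional that is equivalent to the leakage and strictly contracted by `T`. -/
lemma exists_lyapunov_functional {v : E} (hv : ‖v‖ = 1) {T : SuperOp E}
    (hT : IsPositiveTracePreserving T) (hTv : T (ketbra v) = ketbra v) {k : ℕ} (hk : 1 ≤ k)
    (hTk : ∀ X : Op E, 0 ≤ X →
      reTraceMul (perpProj v) ((T ^ k) X) ≤ 1 / 2 * reTraceMul (perpProj v) X) :
    ∃ w : Op E →ₗ[ℝ] ℝ, ∀ X, 0 ≤ X → reTraceMul (perpProj v) X ≤ w X ∧
      w X ≤ k * reTraceMul (perpProj v) X ∧ w (T X) ≤ (1 - (2 * k : ℝ)⁻¹) * w X := by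
  let w : Op E →ₗ[ℝ] ℝ := ∑ j ∈ Finset.range k,
    reTraceMul (perpProj v) ∘ₗ ((T ^ j : SuperOp E) : Op E →ₗ[ℂ] Op E).restrictScalars ℝ
  have hw (X : Op E) : w X = ∑ j ∈ Finset.range k, reTraceMul (perpProj v) ((T ^ j) X) := by
    simp only [w, LinearMap.sum_apply]
    rfl
  refine ⟨w, fun X hX ↦ ?_⟩
  have hanti := hT.antitone_leakage_pow hv hTv hX
  have hle : w X ≤ k * reTraceMul (perpProj v) X := by
    rw [hw]
    have := Finset.sum_le_card_nsmul (Finset.range k)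
      (fun j ↦ reTraceMul (perpProj v) ((T ^ j) X)) (reTraceMul (perpProj v) X)
      fun j _ ↦ hanti (Nat.zero_le j)
    simpa using this
  refine ⟨?_, hle, ?_⟩
  · rw [hw]
    exact Finset.single_le_sum (f := fun j ↦ reTraceMul (perpProj v) ((T ^ j) X))
      (fun j _ ↦ leakage_nonneg hv ((hT.pow j).map_nonneg X hX)) (Finset.mem_range.2 hk)
  -- The sum telescopes: one step loses at least half the leakage, hence at least `w X / (2k)`.
  · have hshift : w (T X) - w X =
        reTraceMul (perpProj v) ((T ^ k) X) - reTraceMul (perpProj v) X := by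
      rw [hw, hw, ← Finset.sum_sub_distrib]
      exact Finset.sum_range_sub (fun j ↦ reTraceMul (perpProj v) ((T ^ j) X)) k
    have hk0 : (0 : ℝ) < k := by exact_mod_cast hk
    have h2 : (2 * k : ℝ)⁻¹ * w X ≤ 1 / 2 * reTraceMul (perpProj v) X := by
      rw [inv_mul_le_iff₀ (by positivity)]
      linarith
    linarith [hTk X hX]

/-- Leakage bound along both alternations of a contracting map with a weak unitary flow. -/
lemma leakage_alternating_le {v : E} (hv : ‖v‖ = 1) {T : SuperOp E}
    (hT : IsPositiveTracePreserving T) (hTv : T (ketbra v) = ketbra v) {k : ℕ} (hk : 1 ≤ k)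
    (hTk : ∀ X : Op E, 0 ≤ X →
      reTraceMul (perpProj v) ((T ^ k) X) ≤ 1 / 2 * reTraceMul (perpProj v) X)
    {H : Op E} (hH : IsSelfAdjoint H) (t : ℝ) (n : ℕ) :
    reTraceMul (perpProj v) (((T ∘L unitaryFlow H t) ^ n) (ketbra v)) ≤
        4 * k ^ 3 * (1 + 2 * k) * (|t| * ‖H‖) ^ 2 ∧
      reTraceMul (perpProj v) (((unitaryFlow H t ∘L T) ^ n) (ketbra v)) ≤
        4 * k ^ 3 * (1 + 2 * k) * (|t| * ‖H‖) ^ 2 := by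
  obtain ⟨w, hw⟩ := exists_lyapunov_functional hv hT hTv hk hTk
  have hU := isPositiveTracePreserving_unitaryFlow hH t
  have hk1 : (1 : ℝ) ≤ k := by exact_mod_cast hk
  set r : ℝ := (2 * k : ℝ)⁻¹ with hr
  have hr0 : 0 < r := by positivity
  have hr1 : r ≤ 1 := inv_le_one_of_one_le₀ (by linarith)
  set c : ℝ := (1 + r⁻¹) * (k * (|t| * ‖H‖) ^ 2) with hc
  have hc0 : 0 ≤ c := by positivity
  -- `B = c / r²` is the fixed point of `x ↦ (1 + r) * (1 - r) * x + c`.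
  set B : ℝ := 4 * k ^ 3 * (1 + 2 * k) * (|t| * ‖H‖) ^ 2 with hB
  have hBc : r ^ 2 * B = c := by
    rw [hB, hc, hr, inv_inv]
    field_simp
    ring
  have hw0 (X : Op E) (hX : 0 ≤ X) : 0 ≤ w X := (leakage_nonneg hv hX).trans (hw X hX).1
  have hstepU (X : Op E) (hX : IsState X) : w (unitaryFlow H t X) ≤ (1 + r) * w X + c :=
    positive_functional_unitaryFlow_le w hw0 (by linarith)
      (fun Y hY ↦ (hw Y hY).2.1.trans (by gcongr; exact leakage_le_trace hv hY)) hH t hr0 hX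
  have hstepT (X : Op E) (hX : IsState X) : w (T X) ≤ (1 - r) * w X := (hw X hX.nonneg).2.2
  have hinit : w (ketbra v) ≤ B := by
    refine (hw _ (ketbra_nonneg v)).2.1.trans ?_
    rw [leakage_ketbra hv, mul_zero]
    positivity
  have hTU (n : ℕ) : w (((T ∘L unitaryFlow H t) ^ n) (ketbra v)) ≤ B := by
    induction n with
    | zero => exact hinit
    | succ n ih =>
      rw [pow_succ']
      set Y := ((T ∘L unitaryFlow H t) ^ n) (ketbra v)
      have hY : IsState Y := ((hT.comp hU).pow n).isState_map (isState_ketbra hv)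
      calc w (T (unitaryFlow H t Y)) ≤ (1 - r) * w (unitaryFlow H t Y) :=
            hstepT _ (hU.isState_map hY)
        _ ≤ (1 - r) * ((1 + r) * B + c) := by
            have : 0 ≤ 1 - r := by linarith
            gcongr
            exact (hstepU Y hY).trans (by gcongr)
        _ ≤ B := by nlinarith [mul_nonneg hr0.le hc0]
  have hUT (n : ℕ) : w (((unitaryFlow H t ∘L T) ^ n) (ketbra v)) ≤ B := by
    induction n with
    | zero => exact hinit
    | succ n ih =>
      rw [pow_succ']
      set Y := ((unitaryFlow H t ∘L T) ^ n) (ketbra v)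
      have hY : IsState Y := ((hU.comp hT).pow n).isState_map (isState_ketbra hv)
      calc w (unitaryFlow H t (T Y)) ≤ (1 + r) * w (T Y) + c := hstepU _ (hT.isState_map hY)
        _ ≤ (1 + r) * ((1 - r) * B) + c := by
            have : 0 ≤ 1 - r := by linarith
            gcongr
            exact (hstepT Y hY).trans (by gcongr)
        _ = B := by rw [← hBc]; ring
  exact ⟨(hw _ (((hT.comp hU).pow n).map_nonneg _ (ketbra_nonneg v))).1.trans (hTU n),
    (hw _ (((hU.comp hT).pow n).map_nonneg _ (ketbra_nonneg v))).1.trans (hUT n)⟩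

/-- The order on `ℂ` also requires equal imaginary parts; the trace is real because both factors are
positive. -/
lemma opTrace_perpProj_mul_le_ofReal {v : E} (hv : ‖v‖ = 1) {X : Op E} (hX : 0 ≤ X) {b : ℝ}
    (hb : reTraceMul (perpProj v) X ≤ b) : opTrace (perpProj v * X) ≤ (b : ℂ) := by
  have h := (Complex.nonneg_iff.1
    (opTrace_mul_nonneg (isStarProjection_perpProj hv).nonneg hX)).2
  exact Complex.le_def.2 ⟨hb, by simpa using h.symm⟩

end Lyapunov

theorem theorem4p7 {E : Type*} [NormedAddCommGroup E] [InnerProductSpace ℂ E]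
    [FiniteDimensional ℂ E] [CompleteSpace E]
    (𝒞 : Set (SuperOp E)) (h𝒞_closed : IsClosed 𝒞)
    (h𝒞_channel : ∀ T ∈ 𝒞, IsChannel T)
    (v : E) (hv : ‖v‖ = 1)
    (h𝒞_fixed : ∀ T ∈ 𝒞, ∀ ρ : Op E, IsState ρ → (T ρ = ρ ↔ ρ = ketbra v)) :
    ∃ C : ℝ, ∀ H : Op E, IsSelfAdjoint H → ∀ T ∈ 𝒞, ∀ N : ℕ, 1 ≤ N →
      opTrace (perpProj v * ((T ∘L unitaryFlow H (1 / (N : ℝ))) ^ N) (ketbra v))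
          ≤ ((C * ‖H‖ ^ 2 / (N : ℝ) ^ 2 : ℝ) : ℂ) ∧
      opTrace (perpProj v *
          ∑ n ∈ Finset.range N, ((unitaryFlow H (1 / (N : ℝ)) ∘L T) ^ n) (ketbra v))
          ≤ ((C * ‖H‖ ^ 2 / (N : ℝ) : ℝ) : ℂ) := by
  have hptp (T) (hT : T ∈ 𝒞) := (h𝒞_channel T hT).isPositiveTracePreserving
  obtain ⟨k, hk, hcontr⟩ := exists_uniform_leakage_contraction h𝒞_closed hptp hv h𝒞_fixed
  refine ⟨4 * k ^ 3 * (1 + 2 * k), fun H hH T hTC N hN ↦ ?_⟩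
  have hT := hptp T hTC
  have hN0 : (0 : ℝ) < N := by exact_mod_cast hN
  have hU := isPositiveTracePreserving_unitaryFlow hH (1 / (N : ℝ))
  have hbound := leakage_alternating_le hv hT ((h𝒞_fixed T hTC _ (isState_ketbra hv)).2 rfl) hk
    (hcontr T hTC) hH (1 / (N : ℝ))
  have hB : (4 * k ^ 3 * (1 + 2 * k) : ℝ) * (|1 / (N : ℝ)| * ‖H‖) ^ 2 =
      4 * k ^ 3 * (1 + 2 * k) * ‖H‖ ^ 2 / (N : ℝ) ^ 2 := by
    rw [abs_of_pos (by positivity)]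
    field_simp
  rw [hB] at hbound
  have hpos (n : ℕ) : 0 ≤ ((unitaryFlow H (1 / (N : ℝ)) ∘L T) ^ n) (ketbra v) :=
    ((hU.comp hT).pow n).map_nonneg _ (ketbra_nonneg v)
  refine ⟨opTrace_perpProj_mul_le_ofReal hv
    (((hT.comp hU).pow N).map_nonneg _ (ketbra_nonneg v)) (hbound N).1,
    opTrace_perpProj_mul_le_ofReal hv (Finset.sum_nonneg fun n _ ↦ hpos n) ?_⟩
  rw [map_sum]
  refine (Finset.sum_le_card_nsmul _ _ _ fun n _ ↦ (hbound n).2).trans_eq ?_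
  rw [Finset.card_range, nsmul_eq_mul]
  field_simp
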